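/- Let $\mathsf{Alex}$ be the category of Alexandroff-discrete topological spaces (arbitrary intersections of open sets are open) and continuous maps, and let $U:\mathsf{T_0Alex}\to\mathsf{Alex}$ be the inclusion of the full subcategory of $T_0$ Alexandroff-discrete spaces, with left adjoint $F$ sending a space to its $T_0$ quotient (points with the same closure are identified). Let $\mathcal E$ be the class of morphisms of $\mathsf{Alex}$ inverted by $F$, and let $\mathcal M$ (the trivial coverings) be the closure under pullbacks of the class of morphisms lying in $\mathsf{T_0Alex}$. Let $\mathcal E'$ be the class of morphisms that are stably in $\mathcal E$, i.e. all of whose pullbacks are in $\mathcal E$. Let $\mathcal M^*$ be the class of coverings, i.e. of the morphisms $f:A\to B$ for which there is an effective descent morphism $p:X\to B$ (a morphism whose pullback functor $p^*:\mathsf{Alex}/B\to\mathsf{Alex}/X$ is monadic) such that the projection $X\times_B A\to X$ is in $\mathcal M$. Then $(\mathcal E',\mathcal M^*)$ is an (orthogonal) factorization system in $\mathsf{Alex}$, namely the monotone-light factorization system induced by the adjunction $F\dashv U$. Moreover, for every morphism $f:A\to B$ in $\mathsf{Alex}$: (a) $f\in\mathcal M^*$ if and only if each fibre of $f$ is $T_0$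 as a subspace of $A$. (b) $f\in\mathcal E'$ if and only if the following three conditions hold: $f$ is surjective; the topology of $B$ is the finest Alexandroff-discrete topology on the set $B$ making $f:A\to B$ continuous; each fibre of $f$, as a subspace of $A$, has the trivial (indiscrete) topology. -/

import Mathlib

open CategoryTheory CategoryTheory.Limits Topology

universe v u v' u'

/-! ### Factorization systems, and the classes of morphisms attached to a reflection -/

section General

variable {C : Type u} [Category.{v} C]

/-- `(E, M)` is an (orthogonal) factorization system: both classes are closed under composition
with isomorphisms, every morphism factors as a morphism of `E` followed by one of `M`, and every
commutative square with left side in `E` and right side in `M` has a unique diagonal. -/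
structure IsFactorizationSystem (E M : MorphismProperty C) : Prop where
  left_respectsIso : E.RespectsIso
  right_respectsIso : M.RespectsIso
  factorization : ∀ {X Y : C} (f : X ⟶ Y), ∃ (Z : C) (e : X ⟶ Z) (m : Z ⟶ Y),
    E e ∧ M m ∧ e ≫ m = f
  orthogonal : ∀ {X Y Z W : C} (e : X ⟶ Y) (m : Z ⟶ W) (a : X ⟶ Z) (b : Y ⟶ W),
    E e → M m → a ≫ m = e ≫ b → ∃! d : Y ⟶ Z, e ≫ d = a ∧ d ≫ m = b

/-- `p : X ⟶ Y` is an effective descent morphism: the pullback functor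
`p^* : C / Y ⥤ C / X` is monadic. -/
def IsEffectiveDescent [HasPullbacks C] {X Y : C} (p : X ⟶ Y) : Prop :=
  Nonempty (MonadicRightAdjoint (Over.pullback p))

variable {D : Type u'} [Category.{v'} D] {F : C ⥤ D} {U : D ⥤ C}

/-- The class `𝓔` of a reflection `F ⊣ U`: the morphisms inverted by `F`. -/
def reflectionE (_adj : F ⊣ U) : MorphismProperty C :=
  fun _ _ f => IsIso (F.map f)

/-- The class `𝓜` (trivial coverings) of a reflection `F ⊣ U`: the closure under pullbacks of the
class of morphisms lying in the subcategory. -/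
def reflectionM (_adj : F ⊣ U) : MorphismProperty C :=
  fun A B f => ∃ (X Y : D) (g : X ⟶ Y) (a : A ⟶ U.obj X) (b : B ⟶ U.obj Y),
    IsPullback a f (U.map g) b

/-- The class `𝓔'`: the morphisms that are stably in `𝓔`, that is, all of whose pullbacks
are in `𝓔`. -/
def stableE (adj : F ⊣ U) : MorphismProperty C :=
  (reflectionE adj).universally

/-- The class `𝓜*` of coverings: `f : A ⟶ B` is a covering if, for some effective descent
morphism `p : X ⟶ B`, the projection `X ×_B A ⟶ X` is in `𝓜`. -/
def coveringM [HasPullbacks C] (adj : F ⊣ U) : MorphismProperty C :=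
  fun A B f => ∃ (X : C) (p : X ⟶ B), IsEffectiveDescent p ∧
    ∃ (P : C) (p₁ : P ⟶ X) (p₂ : P ⟶ A), IsPullback p₁ p₂ p f ∧ reflectionM adj p₁

end General

/-! ### Alexandroff-discrete spaces and the reflection onto the `T₀` ones -/

namespace AlexDisc

/-- The full subcategory of `T₀` Alexandroff-discrete spaces. -/
abbrev T0Alex : Type (u + 1) :=
  ObjectProperty.FullSubcategory (fun X : AlexDisc.{u} => T0Space X)

/-- The inclusion of the `T₀` Alexandroff-discrete spaces. -/
abbrev t0Inclusion : T0Alex.{u} ⥤ AlexDisc.{u} :=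
  ObjectProperty.ι _

instance separationQuotient_alexandrovDiscrete (X : Type u) [TopologicalSpace X]
    [AlexandrovDiscrete X] : AlexandrovDiscrete (SeparationQuotient X) :=
  inferInstanceAs (AlexandrovDiscrete (Quotient (inseparableSetoid X)))

/-- The universal property of the `T₀` quotient `SeparationQuotient X`, which identifies the points
of `X` that have the same closure. -/
def t0HomEquiv (X : AlexDisc.{u}) (Y : T0Alex.{u}) :
    ((⟨AlexDisc.of (SeparationQuotient X), inferInstanceAs (T0Space (SeparationQuotient X))⟩ :
      T0Alex.{u}) ⟶ Y) ≃ (X ⟶ t0Inclusion.obj Y) where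
  toFun f := ConcreteCategory.ofHom
    ((ConcreteCategory.hom f.hom).comp ⟨SeparationQuotient.mk, SeparationQuotient.continuous_mk⟩)
  invFun g := ObjectProperty.homMk <| ConcreteCategory.ofHom
    ⟨SeparationQuotient.lift (ConcreteCategory.hom g) (fun _ _ h =>
        haveI : T0Space (t0Inclusion.obj Y) := Y.property
        ((h.map (ConcreteCategory.hom g).continuous).eq : g _ = g _)),
      SeparationQuotient.continuous_lift (ConcreteCategory.hom g).continuous⟩
  left_inv f := by
    ext x
    obtain ⟨x, rfl⟩ := SeparationQuotient.surjective_mk x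
    rfl
  right_inv g := by
    ext x
    rfl

/-- The reflector `F`, with `F X` the `T₀` quotient of `X`. -/
def t0Reflector : AlexDisc.{u} ⥤ T0Alex.{u} :=
  Adjunction.leftAdjointOfEquiv t0HomEquiv (fun _ _ _ _ _ => rfl)

/-- The adjunction `F ⊣ U` between Alexandroff-discrete spaces and `T₀` ones. -/
def t0Adjunction : t0Reflector.{u} ⊣ t0Inclusion.{u} :=
  Adjunction.adjunctionOfEquivLeft t0HomEquiv (fun _ _ _ _ _ => rfl)

/-- The unit of the adjunction is the canonical projection onto the `T₀` quotient. -/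
theorem t0Adjunction_unit_app (X : AlexDisc.{u}) :
    (ConcreteCategory.hom (t0Adjunction.unit.app X) : X → SeparationQuotient X) =
      SeparationQuotient.mk :=
  rfl

/-- Pullbacks of Alexandroff-discrete spaces are computed as subspaces of products. -/
instance hasPullbacks : HasPullbacks AlexDisc.{u} := by
  refine @hasPullbacks_of_hasLimit_cospan _ _ ?_
  intro X Y Z f g
  let P : AlexDisc.{u} := AlexDisc.of {x : X × Y // f x.1 = g x.2}
  let fst : P ⟶ X := ConcreteCategory.ofHom
    ⟨fun x : {x : X × Y // f x.1 = g x.2} => x.1.1, by fun_prop⟩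
  let snd : P ⟶ Y := ConcreteCategory.ofHom
    ⟨fun x : {x : X × Y // f x.1 = g x.2} => x.1.2, by fun_prop⟩
  have w : fst ≫ f = snd ≫ g := by
    ext x
    exact x.2
  refine ⟨⟨⟨PullbackCone.mk fst snd w, PullbackCone.IsLimit.mk w (fun s => ConcreteCategory.ofHom
    (⟨fun x => ⟨(s.fst x, s.snd x), ConcreteCategory.congr_hom s.condition x⟩, ?_⟩ :
      C(s.pt, {x : X × Y // f x.1 = g x.2}))) ?_ ?_ ?_⟩⟩⟩
  · exact ((ConcreteCategory.hom s.fst).continuous.prodMk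
      (ConcreteCategory.hom s.snd).continuous).subtype_mk _
  · intro s
    rfl
  · intro s
    rfl
  · intro s m h₁ h₂
    ext x
    · exact ConcreteCategory.congr_hom h₁ x
    · exact ConcreteCategory.congr_hom h₂ x

end AlexDisc

namespace AlexDisc

/-! ### Alexandroff-discrete spaces through the specialization preorder -/

/-! An Alexandroff-discrete space is a preorder under `⤳`: open sets are the sets closed under
passing to `x` from `y` when `x ⤳ y`, continuous maps are the monotone ones, and pullbacks are
computed on points and on `⤳`.

The reflector inverts `f` iff `f` reflects `⤳` and meets every inseparability class. Pulling back
along points turns the latter into surjectivity, so `𝓔'` consists of the surjective inducing maps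
(`stableE_iff_surjective_isInducing`), which `surjective_isInducing_iff` rewrites as (b).

For (a), effective descent morphisms are surjective, and trivial coverings have `T₀` fibres, so
coverings do too. Conversely, every `B` has a `T₀` cover lifting chains `b₀ ⤳ b₁ ⤳ b₂`. Such a map
is of effective descent by Beck's theorem (`LiftsChains.isEffectiveDescent`), and pulling a map with
`T₀` fibres back along the cover gives a map between `T₀` spaces.

The factorization of `f` divides `A` by inseparability within the fibres of `f`. -/

theorem continuous_of_specializes {X Y : Type*} [TopologicalSpace X] [TopologicalSpace Y]
    [AlexandrovDiscrete X] {f : X → Y} (h : ∀ x y, x ⤳ y → f x ⤳ f y) : Continuous f := by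
  refine ⟨fun s hs => isOpen_iff_forall_specializes.2 fun x y hxy hy => ?_⟩
  exact (h x y hxy).mem_open hs hy

theorem isInducing_iff_specializes {X Y : Type*} [TopologicalSpace X] [TopologicalSpace Y]
    [AlexandrovDiscrete X] [AlexandrovDiscrete Y] {f : X → Y} :
    IsInducing f ↔ Continuous f ∧ ∀ x y, f x ⤳ f y → x ⤳ y := by
  refine ⟨fun h => ⟨h.continuous, fun x y => h.specializes_iff.1⟩, fun ⟨hc, h⟩ => ?_⟩
  rw [isInducing_iff, TopologicalSpace.ext_iff]
  intro s
  rw [isOpen_induced_iff]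
  -- The smallest open set containing `f '' s` pulls back to `s`, because `f` reflects `⤳`.
  refine ⟨fun hs => ⟨nhdsKer (f '' s), isOpen_nhdsKer, ?_⟩, ?_⟩
  · ext x
    simp only [Set.mem_preimage, mem_nhdsKer_iff_specializes]
    constructor
    · rintro ⟨_, ⟨y, hy, rfl⟩, hxy⟩
      exact (h x y hxy).mem_open hs hy
    · exact fun hx => ⟨f x, ⟨x, hx, rfl⟩, specializes_rfl⟩
  · rintro ⟨t, ht, rfl⟩
    exact ht.preimage hc

theorem specializes_map {X Y : AlexDisc.{u}} (f : X ⟶ Y) {x x' : X} (h : x ⤳ x') : f x ⤳ f x' :=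
  h.map (ConcreteCategory.hom f).continuous

theorem isIso_iff {X Y : AlexDisc.{u}} (f : X ⟶ Y) :
    IsIso f ↔ Function.Bijective f ∧ ∀ x x' : X, f x ⤳ f x' → x ⤳ x' := by
  constructor
  · intro _
    have h₁ (x : X) : inv f (f x) = x := ConcreteCategory.congr_hom (IsIso.hom_inv_id f) x
    have h₂ (y : Y) : f (inv f y) = y := ConcreteCategory.congr_hom (IsIso.inv_hom_id f) y
    refine ⟨⟨Function.LeftInverse.injective h₁, Function.RightInverse.surjective h₂⟩, ?_⟩
    intro x x' h
    simpa only [h₁] using specializes_map (inv f) h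
  · rintro ⟨hb, h⟩
    let e := Equiv.ofBijective f hb
    have he (y : Y) : f (e.symm y) = y := e.apply_symm_apply y
    let g : Y ⟶ X := ConcreteCategory.ofHom ⟨e.symm, continuous_of_specializes fun y y' hy =>
      h _ _ (by rwa [he, he])⟩
    refine ⟨g, ?_, ?_⟩
    · ext x
      exact e.symm_apply_apply x
    · ext y
      exact e.apply_symm_apply y

/-! ### Points and specializations of pullbacks -/

section Pullback

variable {P X Y Z : AlexDisc.{u}} {fst : P ⟶ X} {snd : P ⟶ Y} {f : X ⟶ Z} {g : Y ⟶ Z}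

/-- The map from the one-point space with value `x`. -/
def point {X : AlexDisc.{u}} (x : X) : AlexDisc.of PUnit.{u + 1} ⟶ X :=
  ConcreteCategory.ofHom (ContinuousMap.const _ x)

theorem isPullback_ext (h : IsPullback fst snd f g) {z z' : P} (h₁ : fst z = fst z')
    (h₂ : snd z = snd z') : z = z' := by
  have : point z = point z' := h.hom_ext (by ext; exact h₁) (by ext; exact h₂)
  exact ConcreteCategory.congr_hom this PUnit.unit

theorem isPullback_exists (h : IsPullback fst snd f g) {x : X} {y : Y} (hxy : f x = g y) :
    ∃ z : P, fst z = x ∧ snd z = y :=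
  ⟨h.lift (point x) (point y) (by ext; exact hxy) PUnit.unit,
    ConcreteCategory.congr_hom (h.lift_fst (point x) (point y) _) PUnit.unit,
    ConcreteCategory.congr_hom (h.lift_snd (point x) (point y) _) PUnit.unit⟩

theorem isPullback_condition (h : IsPullback fst snd f g) (z : P) : f (fst z) = g (snd z) :=
  ConcreteCategory.congr_hom h.w z

/-- In the concrete fibre product `Q` specialization is componentwise by construction, and the
comparison map `Q ⟶ P` is continuous. -/
theorem isPullback_specializes (h : IsPullback fst snd f g) {z z' : P} (h₁ : fst z ⤳ fst z')
    (h₂ : snd z ⤳ snd z') : z ⤳ z' := by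
  let Q : AlexDisc.{u} := AlexDisc.of {x : X × Y // f x.1 = g x.2}
  let q₁ : Q ⟶ X := ConcreteCategory.ofHom
    ⟨fun x : {x : X × Y // f x.1 = g x.2} => x.1.1, by fun_prop⟩
  let q₂ : Q ⟶ Y := ConcreteCategory.ofHom
    ⟨fun x : {x : X × Y // f x.1 = g x.2} => x.1.2, by fun_prop⟩
  have w : q₁ ≫ f = q₂ ≫ g := by
    ext x
    exact x.2
  let e (z : P) : Q := ⟨(fst z, snd z), isPullback_condition h z⟩
  have he (z : P) : h.lift q₁ q₂ w (e z) = z :=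
    isPullback_ext h (ConcreteCategory.congr_hom (h.lift_fst q₁ q₂ w) (e z))
      (ConcreteCategory.congr_hom (h.lift_snd q₁ q₂ w) (e z))
  have : e z ⤳ e z' := (subtype_specializes_iff _ _).2 (h₁.prod h₂)
  simpa only [he] using specializes_map (h.lift q₁ q₂ w) this

end Pullback

/-! ### The class `𝓔'` -/

theorem isIso_t0Reflector_map_iff {A B : AlexDisc.{u}} (f : A ⟶ B) :
    IsIso (t0Reflector.map f) ↔
      (∀ a a' : A, f a ⤳ f a' → a ⤳ a') ∧ ∀ b : B, ∃ a : A, Inseparable (f a) b := by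
  have hmk (X : AlexDisc.{u}) (x x' : X) :
      t0Adjunction.unit.app X x ⤳ t0Adjunction.unit.app X x' ↔ x ⤳ x' :=
    SeparationQuotient.isInducing_mk.specializes_iff
  have heq (X : AlexDisc.{u}) (x x' : X) :
      t0Adjunction.unit.app X x = t0Adjunction.unit.app X x' ↔ Inseparable x x' :=
    SeparationQuotient.mk_eq_mk
  have hsurj (X : AlexDisc.{u}) : Function.Surjective (t0Adjunction.unit.app X) :=
    SeparationQuotient.surjective_mk
  have hnat (a : A) : t0Inclusion.map (t0Reflector.map f) (t0Adjunction.unit.app A a) =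
      t0Adjunction.unit.app B (f a) :=
    ConcreteCategory.congr_hom (t0Adjunction.unit_naturality f) a
  have key : IsIso (t0Reflector.map f) ↔ IsIso (t0Inclusion.map (t0Reflector.map f)) :=
    (isIso_iff_of_reflects_iso _ t0Inclusion).symm
  rw [key, isIso_iff]
  constructor
  · rintro ⟨⟨-, hs⟩, h⟩
    refine ⟨fun a a' haa' => ?_, fun b => ?_⟩
    · rw [← hmk]
      apply h
      rwa [hnat, hnat, hmk]
    · obtain ⟨y, hy⟩ := hs (t0Adjunction.unit.app B b)
      obtain ⟨a, rfl⟩ := hsurj A y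
      exact ⟨a, (heq _ _ _).1 ((hnat a).symm.trans hy)⟩
  · rintro ⟨h, hs⟩
    refine ⟨⟨fun x x' hxx' => ?_, fun y => ?_⟩, fun x x' hxx' => ?_⟩
    · obtain ⟨a, rfl⟩ := hsurj A x
      obtain ⟨a', rfl⟩ := hsurj A x'
      rw [hnat, hnat, heq] at hxx'
      exact (heq _ _ _).2 ((h _ _ hxx'.specializes).antisymm (h _ _ hxx'.specializes'))
    · obtain ⟨b, rfl⟩ := hsurj B y
      obtain ⟨a, ha⟩ := hs b
      exact ⟨t0Adjunction.unit.app A a, (hnat a).trans ((heq _ _ _).2 ha)⟩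
    · obtain ⟨a, rfl⟩ := hsurj A x
      obtain ⟨a', rfl⟩ := hsurj A x'
      rw [hnat, hnat, hmk] at hxx'
      exact (hmk _ _ _).2 (h _ _ hxx')

theorem stableE_iff_surjective_isInducing {A B : AlexDisc.{u}} (f : A ⟶ B) :
    stableE t0Adjunction.{u} f ↔ Function.Surjective f ∧ IsInducing f := by
  constructor
  · intro h
    have hf := (isIso_t0Reflector_map_iff f).1 (h (𝟙 A) (𝟙 B) f IsPullback.of_id_snd)
    refine ⟨fun b => ?_, isInducing_iff_specializes.2
      ⟨(ConcreteCategory.hom f).continuous, hf.1⟩⟩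
    -- The pullback along a point is the fibre over `b`; being in `𝓔`, its projection to the point
    -- forces it to be nonempty.
    have hp := IsPullback.of_hasPullback (point b) f
    obtain ⟨z, -⟩ := ((isIso_t0Reflector_map_iff _).1 (h _ _ _ hp)).2 PUnit.unit
    exact ⟨_, (isPullback_condition hp z).symm⟩
  · rintro ⟨hs, hi⟩ A' B' i₁ i₂ f' h
    refine (isIso_t0Reflector_map_iff f').2 ⟨fun z z' hz => ?_, fun y => ?_⟩
    · refine isPullback_specializes h hz ((isInducing_iff_specializes.1 hi).2 _ _ ?_)
      rw [← isPullback_condition h, ← isPullback_condition h]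
      exact specializes_map i₂ hz
    · obtain ⟨a, ha⟩ := hs (i₂ y)
      obtain ⟨z, rfl, -⟩ := isPullback_exists h ha.symm
      exact ⟨z, Inseparable.rfl⟩

theorem surjective_isInducing_iff {A B : AlexDisc.{u}} (f : A ⟶ B) :
    (Function.Surjective f ∧ IsInducing f) ↔
      Function.Surjective (f : A → B) ∧
        IsLeast {t : TopologicalSpace B |
          @AlexandrovDiscrete B t ∧ Continuous[A.str, t] (f : A → B)} B.str ∧
        ∀ b : B, IndiscreteTopology ((f : A → B) ⁻¹' {b}) := by
  have hcont : Continuous f := (ConcreteCategory.hom f).continuous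
  refine and_congr_right fun hs => ⟨fun hi => ⟨⟨⟨B.is_alexandrovDiscrete, hcont⟩, ?_⟩, ?_⟩, ?_⟩
  · have hopen (s : Set B) (h : IsOpen (f ⁻¹' s)) : IsOpen s := by
      obtain ⟨s', hs', h⟩ := hi.isOpen_iff.1 h
      rwa [hs.preimage_injective h] at hs'
    rintro t ⟨-, ht⟩ s hts
    exact hopen s (@Continuous.isOpen_preimage _ _ _ t _ ht s hts)
  · refine fun b => ?_
    rw [TopologicalSpace.indiscrete_iff_forall_inseparable]
    rintro ⟨a, rfl⟩ ⟨a', ha'⟩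
    exact (subtype_inseparable_iff _ _).2 (hi.inseparable_iff.1 (.of_eq ha'.symm))
  · rintro ⟨⟨-, hl⟩, hind⟩
    -- Smaller means finer in this order, and the coinduced topology is itself Alexandroff-discrete,
    -- so it competes with `B.str`.
    have hle : B.str ≤ TopologicalSpace.coinduced f A.str :=
      hl ⟨alexandrovDiscrete_coinduced, continuous_coinduced_rng⟩
    refine isInducing_iff_specializes.2 ⟨hcont, fun a a' h => ?_⟩
    -- Indiscrete fibres make every open set saturated, so the image of the smallest neighbourhood
    -- of `a'` is open.
    have hsat : f ⁻¹' (f '' nhdsKer {a'}) = nhdsKer {a'} := by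
      refine (Set.subset_preimage_image _ _).antisymm' ?_
      rintro x ⟨y, hy, hxy⟩
      have : Inseparable (⟨x, hxy.symm⟩ : (f : A → B) ⁻¹' {f y}) ⟨y, rfl⟩ := by
        have := hind (f y)
        exact Inseparable.all _ _
      exact ((subtype_inseparable_iff _ _).1 this).mem_open_iff isOpen_nhdsKer |>.2 hy
    have hopen : IsOpen (f '' nhdsKer {a'}) := hle _ (by
      rw [isOpen_coinduced, hsat]
      exact isOpen_nhdsKer)
    have : a ∈ f ⁻¹' (f '' nhdsKer {a'}) :=
      h.mem_open hopen ⟨a', subset_nhdsKer rfl, rfl⟩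
    rw [hsat] at this
    simpa [mem_nhdsKer_iff_specializes] using this

/-! ### Quotients and coequalizers -/

instance quot_alexandrovDiscrete {X : Type*} [TopologicalSpace X] [AlexandrovDiscrete X]
    (r : X → X → Prop) : AlexandrovDiscrete (Quot r) :=
  alexandrovDiscrete_coinduced

/-- In general, specialization in a quotient is generated by zigzags. The hypothesis `hr` shortens
two steps to one, so the classes one step from `b` already form an open set. -/
theorem exists_specializes_of_quot_mk_specializes {X : Type*} [TopologicalSpace X]
    [AlexandrovDiscrete X] {r : X → X → Prop}
    (hr : ∀ a b c d : X, a ⤳ b → Quot.mk r b = Quot.mk r c → c ⤳ d →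
      ∃ a' d', Quot.mk r a' = Quot.mk r a ∧ Quot.mk r d' = Quot.mk r d ∧ a' ⤳ d')
    {a b : X} (h : Quot.mk r a ⤳ Quot.mk r b) :
    ∃ a' b', Quot.mk r a' = Quot.mk r a ∧ Quot.mk r b' = Quot.mk r b ∧ a' ⤳ b' := by
  let V : Set (Quot r) :=
    {y | ∃ a' b', Quot.mk r a' = y ∧ Quot.mk r b' = Quot.mk r b ∧ a' ⤳ b'}
  have hV : IsOpen V := by
    rw [← isQuotientMap_quot_mk.isOpen_preimage, isOpen_iff_forall_specializes]
    rintro x y hxy ⟨a', b', ha', hb', hab'⟩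
    obtain ⟨x', d', hx', hd', hxd'⟩ := hr x y a' b' hxy ha'.symm hab'
    exact ⟨x', d', hx', hd'.trans hb', hxd'⟩
  exact h.mem_open hV ⟨b, b, rfl, rfl, specializes_rfl⟩

section Coequalizer

variable {X Y B : AlexDisc.{u}}

/-- The relation identifying the values of two parallel maps. -/
def CoeqRel (f g : X ⟶ Y) (y y' : Y) : Prop :=
  ∃ x, y = f x ∧ y' = g x

/-- The quotient space coequalizing two parallel maps. -/
abbrev coeqObj (f g : X ⟶ Y) : AlexDisc.{u} :=
  AlexDisc.of (Quot (CoeqRel f g))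

/-- The projection onto the quotient space coequalizing two parallel maps. -/
def coeqMk (f g : X ⟶ Y) : Y ⟶ coeqObj f g :=
  ConcreteCategory.ofHom ⟨Quot.mk (CoeqRel f g), continuous_quot_mk⟩

theorem coeqMk_condition (f g : X ⟶ Y) : f ≫ coeqMk f g = g ≫ coeqMk f g := by
  ext x
  exact Quot.sound ⟨x, rfl, rfl⟩

/-- The map out of the quotient space induced by a coequalizing map. -/
def coeqDesc (f g : X ⟶ Y) (k : Y ⟶ B) (hk : f ≫ k = g ≫ k) : coeqObj f g ⟶ B :=
  ConcreteCategory.ofHom ⟨Quot.lift k (by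
    rintro _ _ ⟨x, rfl, rfl⟩
    exact ConcreteCategory.congr_hom hk x),
    continuous_quot_lift _ (ConcreteCategory.hom k).continuous⟩

theorem coeqMk_desc (f g : X ⟶ Y) (k : Y ⟶ B) (hk : f ≫ k = g ≫ k) :
    coeqMk f g ≫ coeqDesc f g k hk = k :=
  rfl

theorem coeqMk_surjective (f g : X ⟶ Y) : Function.Surjective (coeqMk f g) :=
  Quot.mk_surjective

theorem coeq_hom_ext {f g : X ⟶ Y} {k l : coeqObj f g ⟶ B}
    (h : coeqMk f g ≫ k = coeqMk f g ≫ l) : k = l := by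
  ext y
  obtain ⟨y, rfl⟩ := coeqMk_surjective f g y
  exact ConcreteCategory.congr_hom h y

theorem over_left_comp_hom {X Y : Over B} (f g : X ⟶ Y) : f.left ≫ Y.hom = g.left ≫ Y.hom := by
  rw [Over.w, Over.w]

/-- The coequalizer of a parallel pair in a slice category. -/
def overCoeq {X Y : Over B} (f g : X ⟶ Y) : Over B :=
  Over.mk (coeqDesc f.left g.left Y.hom (over_left_comp_hom f g))

/-- The projection onto the coequalizer of a parallel pair in a slice category. -/
def overCoeqπ {X Y : Over B} (f g : X ⟶ Y) : Y ⟶ overCoeq f g :=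
  Over.homMk (coeqMk f.left g.left) (coeqMk_desc f.left g.left Y.hom (over_left_comp_hom f g))

theorem overCoeqπ_condition {X Y : Over B} (f g : X ⟶ Y) :
    f ≫ overCoeqπ f g = g ≫ overCoeqπ f g := by
  ext1
  exact coeqMk_condition f.left g.left

/-- The cofork on `overCoeqπ f g` is a coequalizer. -/
def overCoeqIsColimit {X Y : Over B} (f g : X ⟶ Y) :
    IsColimit (Cofork.ofπ (overCoeqπ f g) (overCoeqπ_condition f g)) :=
  have hs (s : Cofork f g) : f.left ≫ s.π.left = g.left ≫ s.π.left := by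
    rw [← Over.comp_left, s.condition, Over.comp_left]
  Cofork.IsColimit.mk _
    (fun s => Over.homMk (U := overCoeq f g) (coeqDesc f.left g.left s.π.left (hs s))
      (coeq_hom_ext (f := f.left) (g := g.left) (Over.w s.π)))
    (fun s => by
      ext1
      exact coeqMk_desc f.left g.left s.π.left (hs s))
    (fun s m hm => by
      ext1
      exact coeq_hom_ext (f := f.left) (g := g.left) (congrArg Over.Hom.left hm))

end Coequalizer

/-! ### Effective descent morphisms -/

/-- Every chain `b₀ ⤳ b₁ ⤳ b₂` in the codomain of `p` lifts along `p`. -/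
def LiftsChains {X B : AlexDisc.{u}} (p : X ⟶ B) : Prop :=
  ∀ b₀ b₁ b₂ : B, b₀ ⤳ b₁ → b₁ ⤳ b₂ →
    ∃ x₀ x₁ x₂ : X, p x₀ = b₀ ∧ p x₁ = b₁ ∧ p x₂ = b₂ ∧ x₀ ⤳ x₁ ∧ x₁ ⤳ x₂

namespace LiftsChains

variable {X B : AlexDisc.{u}} {p : X ⟶ B}

theorem surjective (hp : LiftsChains p) : Function.Surjective p := fun b =>
  let ⟨x, _, _, hx, _⟩ := hp b b b specializes_rfl specializes_rfl
  ⟨x, hx⟩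

theorem isIso_of_isIso_pullback (hp : LiftsChains p) {A A' P P' : AlexDisc.{u}} {π : A ⟶ B}
    {π' : A' ⟶ B} {fst : P ⟶ A} {snd : P ⟶ X} {fst' : P' ⟶ A'} {snd' : P' ⟶ X}
    (hP : IsPullback fst snd π p) (hP' : IsPullback fst' snd' π' p)
    (h : A ⟶ A') (k : P ⟶ P') (hh : h ≫ π' = π) (h₁ : k ≫ fst' = fst ≫ h) (h₂ : k ≫ snd' = snd)
    [IsIso k] : IsIso h := by
  have eh (a : A) : π' (h a) = π a := ConcreteCategory.congr_hom hh a
  have e₁ (z : P) : fst' (k z) = h (fst z) := ConcreteCategory.congr_hom h₁ z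
  have e₂ (z : P) : snd' (k z) = snd z := ConcreteCategory.congr_hom h₂ z
  obtain ⟨⟨hki, hks⟩, hk⟩ := (isIso_iff k).1 inferInstance
  rw [isIso_iff]
  refine ⟨⟨fun a a' haa' => ?_, fun a' => ?_⟩, fun a a' haa' => ?_⟩
  · obtain ⟨x, hx⟩ := hp.surjective (π a)
    obtain ⟨z, hz, hzx⟩ := isPullback_exists hP hx.symm
    obtain ⟨z', hz', hzx'⟩ := isPullback_exists hP
      (show π a' = p x by rw [hx, ← eh, ← eh, haa'])
    have : z = z' := hki (isPullback_ext hP' (by rw [e₁, e₁, hz, hz', haa'])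
      (by rw [e₂, e₂, hzx, hzx']))
    rw [← hz, ← hz', this]
  · obtain ⟨x, hx⟩ := hp.surjective (π' a')
    obtain ⟨z', hz', -⟩ := isPullback_exists hP' hx.symm
    obtain ⟨z, rfl⟩ := hks z'
    exact ⟨fst z, by rw [← e₁, hz']⟩
  · have hππ : π a ⤳ π a' := by
      rw [← eh, ← eh]
      exact specializes_map π' haa'
    -- Only a pair has to be lifted here, so the last point of the chain is repeated.
    obtain ⟨x, x', -, hx, hx', -, hxx', -⟩ := hp _ _ _ hππ specializes_rfl
    obtain ⟨z, hz, hzx⟩ := isPullback_exists hP hx.symm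
    obtain ⟨z', hz', hzx'⟩ := isPullback_exists hP hx'.symm
    rw [← hz, ← hz']
    refine specializes_map fst (hk _ _ (isPullback_specializes hP' ?_ ?_))
    · rwa [e₁, e₁, hz, hz']
    · rwa [e₂, e₂, hzx, hzx']

/-- Here `S` is the split coequalizer of the pulled-back pair and `R` the pullback of the
coequalizer. Identifications lift fibrewise to `P`. For specializations, the section `s` turns a
relation in `S` into one in `P`, and chain lifting supplies the relations in `S`. -/
theorem isIso_coequalizer_comparison (hp : LiftsChains p) {A' A P' P R S : AlexDisc.{u}}
    {π : A ⟶ B} {f g : A' ⟶ A} (hfg : f ≫ π = g ≫ π)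
    {fst' : P' ⟶ A'} {snd' : P' ⟶ X} (hP' : IsPullback fst' snd' (f ≫ π) p)
    {fst : P ⟶ A} {snd : P ⟶ X} (hP : IsPullback fst snd π p)
    {fstR : R ⟶ coeqObj f g} {sndR : R ⟶ X} (hR : IsPullback fstR sndR (coeqDesc f g π hfg) p)
    {F G : P' ⟶ P} (hF₁ : F ≫ fst = fst' ≫ f) (hF₂ : F ≫ snd = snd')
    (hG₁ : G ≫ fst = fst' ≫ g) (hG₂ : G ≫ snd = snd')
    {q : P ⟶ S} (hq : F ≫ q = G ≫ q) (s : S ⟶ P) (hs : s ≫ q = 𝟙 S)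
    (c : S ⟶ R) (hc₁ : q ≫ c ≫ fstR = fst ≫ coeqMk f g) (hc₂ : q ≫ c ≫ sndR = snd) :
    IsIso c := by
  have eF₁ (z : P') : fst (F z) = f (fst' z) := ConcreteCategory.congr_hom hF₁ z
  have eF₂ (z : P') : snd (F z) = snd' z := ConcreteCategory.congr_hom hF₂ z
  have eG₁ (z : P') : fst (G z) = g (fst' z) := ConcreteCategory.congr_hom hG₁ z
  have eG₂ (z : P') : snd (G z) = snd' z := ConcreteCategory.congr_hom hG₂ z
  have eq (z : P') : q (F z) = q (G z) := ConcreteCategory.congr_hom hq z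
  have es (y : S) : q (s y) = y := ConcreteCategory.congr_hom hs y
  have ec₁ (z : P) : fstR (c (q z)) = coeqMk f g (fst z) := ConcreteCategory.congr_hom hc₁ z
  have ec₂ (z : P) : sndR (c (q z)) = snd z := ConcreteCategory.congr_hom hc₂ z
  have eπ (a : A) : coeqDesc f g π hfg (coeqMk f g a) = π a := rfl
  have hqs : Function.Surjective q := fun y => ⟨s y, es y⟩
  -- Since `π` factors through the coequalizer, a whole zigzag of identifications lies over one
  -- point of `B` and lifts to `P` with constant `X`-coordinate.
  have hgen (a a' : A) (h : Relation.EqvGen (CoeqRel f g) a a') :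
      ∀ z z' : P, fst z = a → fst z' = a' → snd z = snd z' → q z = q z' := by
    induction h with
    | rel a a' h =>
      obtain ⟨x, rfl, rfl⟩ := h
      intro z z' hz hz' hzz'
      have hx : (f ≫ π) x = p (snd z) := by
        rw [← isPullback_condition hP, hz]
        rfl
      obtain ⟨w, hw, hwz⟩ := isPullback_exists hP' hx
      have h₁ : F w = z := isPullback_ext hP (by rw [eF₁, hw, hz]) (by rw [eF₂, hwz])
      have h₂ : G w = z' := isPullback_ext hP (by rw [eG₁, hw, hz']) (by rw [eG₂, hwz, hzz'])
      rw [← h₁, ← h₂, eq]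
    | refl a =>
      intro z z' hz hz' hzz'
      rw [isPullback_ext hP (hz.trans hz'.symm) hzz']
    | symm a a' _ ih => exact fun z z' hz hz' hzz' => (ih z' z hz' hz hzz'.symm).symm
    | trans a a' a'' h _ ih ih' =>
      intro z z'' hz hz'' hzz''
      have ha : π a' = p (snd z) := by
        rw [← isPullback_condition hP, hz]
        exact congrArg (coeqDesc f g π hfg) (Quot.eqvGen_sound h).symm
      obtain ⟨z', hz', hzz'⟩ := isPullback_exists hP ha
      exact (ih z z' hz hz' hzz'.symm).trans (ih' z' z'' hz' hz'' (hzz'.trans hzz''))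
  have hq_eq (z z' : P) (h₁ : coeqMk f g (fst z) = coeqMk f g (fst z'))
      (h₂ : snd z = snd z') : q z = q z' :=
    hgen _ _ (Quot.eqvGen_exact h₁) z z' rfl rfl h₂
  have hmk (z : P) : coeqMk f g (fst (s (q z))) = coeqMk f g (fst z) := by
    rw [← ec₁, es, ec₁]
  have hspec {a a' : A} (h : coeqMk f g a ⤳ coeqMk f g a') :
      ∃ b b' : A, coeqMk f g b = coeqMk f g a ∧ coeqMk f g b' = coeqMk f g a' ∧ b ⤳ b' := by
    refine exists_specializes_of_quot_mk_specializes (fun a₀ a₁ a₁' a₂ h₀ h₁ h₂ => ?_) h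
    have hπ : π a₁ = π a₁' := congrArg (coeqDesc f g π hfg) h₁
    have hπ₂ := specializes_map π h₂
    rw [← hπ] at hπ₂
    -- The two steps lift to `P` over a common `x₁`; their middle points merge under `q`, and `s`
    -- sends the composite relation back to a single step in `P`.
    obtain ⟨x₀, x₁, x₂, hx₀, hx₁, hx₂, hx₀₁, hx₁₂⟩ := hp _ _ _ (specializes_map π h₀) hπ₂
    obtain ⟨z₀, hz₀, hzx₀⟩ := isPullback_exists hP hx₀.symm
    obtain ⟨z₁, hz₁, hzx₁⟩ := isPullback_exists hP hx₁.symm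
    obtain ⟨z₁', hz₁', hzx₁'⟩ := isPullback_exists hP (hπ.symm.trans hx₁.symm)
    obtain ⟨z₂, hz₂, hzx₂⟩ := isPullback_exists hP hx₂.symm
    have h₀₁ : z₀ ⤳ z₁ :=
      isPullback_specializes hP (by rwa [hz₀, hz₁]) (by rwa [hzx₀, hzx₁])
    have h₁₂ : z₁' ⤳ z₂ :=
      isPullback_specializes hP (by rwa [hz₁', hz₂]) (by rwa [hzx₁', hzx₂])
    have hq₁ : q z₁ = q z₁' := hq_eq _ _ (by rw [hz₁, hz₁']; exact h₁) (by rw [hzx₁, hzx₁'])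
    have hq₀₂ : q z₀ ⤳ q z₂ :=
      (specializes_map q h₀₁).trans (by rw [hq₁]; exact specializes_map q h₁₂)
    exact ⟨fst (s (q z₀)), fst (s (q z₂)), by rw [← hz₀]; exact hmk z₀,
      by rw [← hz₂]; exact hmk z₂, specializes_map fst (specializes_map s hq₀₂)⟩
  rw [isIso_iff]
  refine ⟨⟨fun y y' h => ?_, fun w => ?_⟩, fun y y' h => ?_⟩
  · obtain ⟨z, rfl⟩ := hqs y
    obtain ⟨z', rfl⟩ := hqs y'
    exact hq_eq _ _ (by rw [← ec₁, ← ec₁, h]) (by rw [← ec₂, ← ec₂, h])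
  · obtain ⟨a, ha⟩ := coeqMk_surjective f g (fstR w)
    obtain ⟨z, hz, hzw⟩ := isPullback_exists hP
      (show π a = p (sndR w) by rw [← isPullback_condition hR, ← ha, eπ])
    exact ⟨q z, isPullback_ext hR (by rw [ec₁, hz, ha]) (by rw [ec₂, hzw])⟩
  · obtain ⟨z, rfl⟩ := hqs y
    obtain ⟨z', rfl⟩ := hqs y'
    have h₁ := specializes_map fstR h
    have h₂ := specializes_map sndR h
    rw [ec₁, ec₁] at h₁
    rw [ec₂, ec₂] at h₂
    obtain ⟨a, a', ha, ha', haa'⟩ := hspec h₁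
    obtain ⟨t, ht, htz⟩ := isPullback_exists hP
      (show π a = p (snd z) by rw [← isPullback_condition hP, ← eπ, ha, eπ])
    obtain ⟨t', ht', htz'⟩ := isPullback_exists hP
      (show π a' = p (snd z') by rw [← isPullback_condition hP, ← eπ, ha', eπ])
    rw [← hq_eq t z (by rw [ht, ha]) htz, ← hq_eq t' z' (by rw [ht', ha']) htz']
    exact specializes_map q
      (isPullback_specializes hP (by rwa [ht, ht']) (by rwa [htz, htz']))

theorem isEffectiveDescent (hp : LiftsChains p) : IsEffectiveDescent p := by
  have : (Over.pullback p).ReflectsIsomorphisms := ⟨fun {Y Y'} h _ => by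
    have : IsIso ((Over.pullback p).map h).left :=
      inferInstanceAs (IsIso ((Over.forget X).map ((Over.pullback p).map h)))
    have : IsIso ((Over.forget B).map h) := hp.isIso_of_isIso_pullback (IsPullback.of_hasPullback Y.hom p)
      (IsPullback.of_hasPullback Y'.hom p) h.left ((Over.pullback p).map h).left (Over.w h)
      (pullback.lift_fst _ _ _) (pullback.lift_snd _ _ _)
    exact isIso_of_reflects_iso h (Over.forget B)⟩
  have : Monad.HasCoequalizerOfIsSplitPair (Over.pullback p) :=
    ⟨fun f g _ => ⟨⟨⟨_, overCoeqIsColimit f g⟩⟩⟩⟩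
  have : Monad.PreservesColimitOfIsSplitPair (Over.pullback p) := ⟨fun {A' A} f g hsplit => by
    refine preservesColimit_of_preserves_colimit_cocone (overCoeqIsColimit f g) ?_
    refine (isColimitMapCoconeCoforkEquiv (Over.pullback p) (overCoeqπ_condition f g)).symm ?_
    refine Nonempty.some ?_
    obtain ⟨S, q, ⟨hS⟩⟩ := hsplit.splittable
    let c : S ⟶ (Over.pullback p).obj (overCoeq f g) :=
      hS.isCoequalizer.desc (Cofork.ofπ ((Over.pullback p).map (overCoeqπ f g))
        (by rw [← Functor.map_comp, (overCoeqπ_condition f g), Functor.map_comp]))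
    have hqc : q ≫ c = (Over.pullback p).map (overCoeqπ f g) :=
      hS.isCoequalizer.fac _ WalkingParallelPair.one
    have hqc' : q.left ≫ c.left = ((Over.pullback p).map (overCoeqπ f g)).left := by
      rw [← hqc, Over.comp_left]
    have : IsIso ((Over.forget X).map c) := by
      refine hp.isIso_coequalizer_comparison (f := f.left) (g := g.left) (π := A.hom)
        (by simp) (hP' := ?_) (IsPullback.of_hasPullback A.hom p)
        (IsPullback.of_hasPullback (overCoeq f g).hom p)
        (F := ((Over.pullback p).map f).left) (G := ((Over.pullback p).map g).left)
        (fst' := pullback.fst A'.hom p) (snd' := pullback.snd A'.hom p)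
        (pullback.lift_fst _ _ _) (pullback.lift_snd _ _ _)
        (pullback.lift_fst _ _ _) (pullback.lift_snd _ _ _)
        (q := q.left) ?_ hS.rightSection.left ?_ c.left ?_ ?_
      · rw [Over.w f]
        exact IsPullback.of_hasPullback A'.hom p
      · rw [← Over.comp_left, hS.condition, Over.comp_left]
      · rw [← Over.comp_left, hS.rightSection_π, Over.id_left]
      · exact (Category.assoc _ _ _).symm.trans
          ((congrArg (· ≫ pullback.fst (overCoeq f g).hom p) hqc').trans
            (pullback.lift_fst _ _ _))
      · exact (Category.assoc _ _ _).symm.trans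
          ((congrArg (· ≫ pullback.snd (overCoeq f g).hom p) hqc').trans
            (pullback.lift_snd _ _ _))
    have hc : IsIso c := isIso_of_reflects_iso c (Over.forget X)
    exact ⟨hS.isCoequalizer.ofIsoColimit (Cofork.ext (@asIso _ _ _ _ c hc) hqc)⟩⟩
  exact ⟨Monad.monadicOfHasPreservesGSplitCoequalizersOfReflectsIsomorphisms
    (Over.mapPullbackAdj p)⟩

end LiftsChains

/-- If `p` missed `b`, the pullback functor would send the map from the empty space to `{b}` to an
isomorphism, yet monadic functors reflect isomorphisms. -/
theorem _root_.IsEffectiveDescent.surjective {X B : AlexDisc.{u}} {p : X ⟶ B}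
    (hp : IsEffectiveDescent p) : Function.Surjective p := by
  obtain ⟨_⟩ := hp
  by_contra hs
  obtain ⟨b, hb⟩ := not_forall.1 hs
  let E : Over B := Over.mk (ConcreteCategory.ofHom ⟨PEmpty.elim, by fun_prop⟩ :
    AlexDisc.of PEmpty.{u + 1} ⟶ B)
  let T : Over B := Over.mk (point b)
  let h : E ⟶ T := Over.homMk (ConcreteCategory.ofHom ⟨PEmpty.elim, by fun_prop⟩)
    (by ext x; exact x.elim)
  have hT (z : (((Over.pullback p).obj T).left : AlexDisc.{u})) : False :=
    hb ⟨_, (isPullback_condition (IsPullback.of_hasPullback T.hom p) z).symm⟩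
  have : IsIso ((Over.forget X).map ((Over.pullback p).map h)) := by
    rw [isIso_iff]
    exact ⟨⟨fun z => (hT (((Over.pullback p).map h).left z)).elim, fun z => (hT z).elim⟩,
      fun z => (hT (((Over.pullback p).map h).left z)).elim⟩
  have : IsIso ((Over.pullback p).map h) := isIso_of_reflects_iso _ (Over.forget X)
  have : (Over.pullback p).ReflectsIsomorphisms :=
    reflectsIsomorphisms_of_iso (Monad.comparisonForget (monadicAdjunction (Over.pullback p)))
  have : IsIso h := isIso_of_reflects_iso h (Over.pullback p)
  have : IsIso ((Over.forget B).map h) := inferInstance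
  obtain ⟨x, -⟩ := ((isIso_iff _).1 this).1.2 PUnit.unit
  exact x.elim

/-! ### A `T₀` effective descent cover -/

/-- The points of `B` with a height: the underlying set of the `T₀` cover of `B`. -/
def HeightCover (B : Type u) : Type u := B × ℕ

/-- Distinct points are comparable when their projections specialize and the height increases. -/
instance (B : Type u) [TopologicalSpace B] : PartialOrder (HeightCover B) where
  le x y := x = y ∨ x.1 ⤳ y.1 ∧ x.2 < y.2
  le_refl x := Or.inl rfl
  le_trans x y z := by
    rintro (rfl | h) (rfl | h')
    · exact Or.inl rfl
    · exact Or.inr h'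
    · exact Or.inr h
    · exact Or.inr ⟨h.1.trans h'.1, h.2.trans h'.2⟩
  le_antisymm x y := by
    rintro (rfl | h) (h' | h')
    · rfl
    · rfl
    · exact h'.symm
    · exact absurd h.2 h'.2.asymm

/-- The `T₀` cover of `B` by copies of its points indexed by a height. -/
abbrev t0Cover (B : AlexDisc.{u}) : AlexDisc.{u} :=
  AlexDisc.of (WithLowerSet (HeightCover B))

theorem t0Cover_specializes_iff {B : AlexDisc.{u}} (x y : HeightCover B) :
    (WithLowerSet.toLowerSet x : t0Cover B) ⤳ (WithLowerSet.toLowerSet y : t0Cover B) ↔ x ≤ y :=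
  IsLowerSet.specializes_iff_le

/-- The projection of the `T₀` cover of `B`. -/
def t0CoverMap (B : AlexDisc.{u}) : t0Cover B ⟶ B :=
  ConcreteCategory.ofHom ⟨fun x => (WithLowerSet.ofLowerSet x).1,
    continuous_of_specializes fun x y h => by
      obtain h | h := (t0Cover_specializes_iff _ _).1 h
      · exact specializes_of_eq (congrArg Prod.fst h)
      · exact h.1⟩

/-- The strict increase of height keeps points apart even over inseparable points of `B`. -/
instance t0Space_t0Cover (B : AlexDisc.{u}) : T0Space (t0Cover B) where
  t0 _ _ h := le_antisymm (α := HeightCover B) ((t0Cover_specializes_iff _ _).1 h.specializes)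
    ((t0Cover_specializes_iff _ _).1 h.specializes')

theorem liftsChains_t0CoverMap (B : AlexDisc.{u}) : LiftsChains (t0CoverMap B) :=
  fun b₀ b₁ b₂ h h' =>
    ⟨WithLowerSet.toLowerSet (b₀, 0), WithLowerSet.toLowerSet (b₁, 1),
      WithLowerSet.toLowerSet (b₂, 2), rfl, rfl, rfl,
      (t0Cover_specializes_iff _ _).2 (Or.inr ⟨h, Nat.zero_lt_one⟩),
      (t0Cover_specializes_iff _ _).2 (Or.inr ⟨h', Nat.one_lt_two⟩)⟩

/-! ### Coverings -/

theorem t0Space_fiber_iff {A B : AlexDisc.{u}} (f : A ⟶ B) :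
    (∀ b : B, T0Space ((f : A → B) ⁻¹' {b})) ↔
      ∀ a a' : A, f a = f a' → Inseparable a a' → a = a' := by
  constructor
  · intro h a a' hf ha
    have := h (f a)
    exact congrArg Subtype.val (T0Space.t0 (x := (⟨a, rfl⟩ : (f : A → B) ⁻¹' {f a}))
      (y := ⟨a', hf.symm⟩) ((subtype_inseparable_iff _ _).2 ha))
  · refine fun h b => ⟨fun a a' ha => Subtype.ext (h _ _ ?_ ((subtype_inseparable_iff _ _).1 ha))⟩
    exact a.2.trans a'.2.symm

theorem coveringM_iff {A B : AlexDisc.{u}} (f : A ⟶ B) :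
    coveringM t0Adjunction.{u} f ↔ ∀ a a' : A, f a = f a' → Inseparable a a' → a = a' := by
  constructor
  · rintro ⟨X, p, hp, P, p₁, p₂, hP, X', Y', g, i, j, hM⟩ a a' hf ha
    obtain ⟨x, hx⟩ := hp.surjective (f a)
    obtain ⟨z, hz, rfl⟩ := isPullback_exists hP hx
    obtain ⟨z', hz', rfl⟩ := isPullback_exists hP (hx.trans hf)
    have hzz' : Inseparable z z' :=
      (isPullback_specializes hP (by rw [hz, hz']) ha.specializes).antisymm
        (isPullback_specializes hP (by rw [hz, hz']) ha.specializes')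
    have : T0Space (t0Inclusion.obj X') := X'.property
    -- `z` and `z'` share their `p₁`-coordinate and, `X'` being `T₀`, also their `i`-coordinate.
    have hi : i z = i z' :=
      ((specializes_map i hzz'.specializes).antisymm (specializes_map i hzz'.specializes')).eq
    rw [isPullback_ext hM hi (hz.trans hz'.symm)]
  · intro h
    have hP := IsPullback.of_hasPullback (t0CoverMap B) f
    refine ⟨_, t0CoverMap B, (liftsChains_t0CoverMap B).isEffectiveDescent, _, _, _, hP, ?_⟩
    -- Inseparable points agree in the `T₀` cover, hence their images in `A` lie in one fibre of
    -- `f`, where `h` applies.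
    have hT : T0Space ↑(pullback (t0CoverMap B) f).toTopCat := ⟨fun z z' hz => by
      have h₁ : pullback.fst (t0CoverMap B) f z = pullback.fst (t0CoverMap B) f z' :=
        ((specializes_map _ hz.specializes).antisymm (specializes_map _ hz.specializes')).eq
      refine isPullback_ext hP h₁ (h _ _ ?_
        ((specializes_map _ hz.specializes).antisymm (specializes_map _ hz.specializes')))
      rw [← isPullback_condition hP, ← isPullback_condition hP, h₁]⟩
    exact ⟨⟨_, hT⟩, ⟨t0Cover B, t0Space_t0Cover B⟩,
      ObjectProperty.homMk (pullback.fst (t0CoverMap B) f), 𝟙 _, 𝟙 _, IsPullback.of_id_fst⟩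

/-! ### The factorization system -/

/-- The relation whose quotient is the middle object of the monotone-light factorization. -/
def fiberInseparable {A B : AlexDisc.{u}} (f : A ⟶ B) : Setoid A where
  r a a' := f a = f a' ∧ Inseparable a a'
  iseqv := ⟨fun _ => ⟨rfl, .rfl⟩, fun h => ⟨h.1.symm, h.2.symm⟩,
    fun h h' => ⟨h.1.trans h'.1, h.2.trans h'.2⟩⟩

theorem exists_factorization {A B : AlexDisc.{u}} (f : A ⟶ B) :
    ∃ (Z : AlexDisc.{u}) (e : A ⟶ Z) (m : Z ⟶ B),
      stableE t0Adjunction.{u} e ∧ coveringM t0Adjunction.{u} m ∧ e ≫ m = f := by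
  let s := fiberInseparable f
  have : AlexandrovDiscrete (Quotient s) := alexandrovDiscrete_coinduced
  let e : A ⟶ AlexDisc.of (Quotient s) :=
    ConcreteCategory.ofHom ⟨Quotient.mk s, continuous_quot_mk⟩
  let m : AlexDisc.of (Quotient s) ⟶ B :=
    ConcreteCategory.ofHom ⟨Quotient.lift f fun _ _ h => h.1,
      continuous_quot_lift _ (ConcreteCategory.hom f).continuous⟩
  have hs : Function.Surjective e := Quotient.mk_surjective
  have he (a a' : A) (h : e a ⤳ e a') : a ⤳ a' := by
    -- Only inseparable points are identified, so the image of the smallest neighbourhood of `a'` is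
    -- open in the quotient.
    let V : Set (Quotient s) := {y | ∃ x, Quotient.mk s x = y ∧ x ⤳ a'}
    have hV : IsOpen V := by
      rw [← isQuotientMap_quotient_mk'.isOpen_preimage, isOpen_iff_forall_specializes]
      rintro x y hxy ⟨z, hz, hza⟩
      exact ⟨x, rfl, hxy.trans ((Quotient.exact hz).2.specializes'.trans hza)⟩
    obtain ⟨x, hx, hxa⟩ := h.mem_open hV ⟨a', rfl, specializes_rfl⟩
    exact (Quotient.exact hx).2.specializes'.trans hxa
  refine ⟨_, e, m, (stableE_iff_surjective_isInducing e).2 ⟨hs, isInducing_iff_specializes.2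
    ⟨(ConcreteCategory.hom e).continuous, he⟩⟩, (coveringM_iff m).2 ?_, by ext; rfl⟩
  intro y y' hm hy
  obtain ⟨a, rfl⟩ := hs y
  obtain ⟨a', rfl⟩ := hs y'
  exact Quotient.sound ⟨hm, (he _ _ hy.specializes).antisymm (he _ _ hy.specializes')⟩

/-- Fibres of `e` are indiscrete and those of `m` are `T₀`, so `a` is constant on fibres of `e`. The
diagonal is `a` after any set-theoretic section of `e`, monotone because `e` reflects `⤳`. -/
theorem existsUnique_diagonal {X Y Z W : AlexDisc.{u}} (e : X ⟶ Y) (m : Z ⟶ W) (a : X ⟶ Z)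
    (b : Y ⟶ W) (he : Function.Surjective e ∧ IsInducing e)
    (hm : ∀ z z' : Z, m z = m z' → Inseparable z z' → z = z') (w : a ≫ m = e ≫ b) :
    ∃! d : Y ⟶ Z, e ≫ d = a ∧ d ≫ m = b := by
  have hw (x : X) : m (a x) = b (e x) := ConcreteCategory.congr_hom w x
  have hspec := (isInducing_iff_specializes.1 he.2).2
  have ha (x x' : X) (h : e x = e x') : a x = a x' :=
    hm _ _ (by rw [hw, hw, h])
      ((specializes_map a (hspec _ _ (specializes_of_eq h))).antisymm
        (specializes_map a (hspec _ _ (specializes_of_eq h.symm))))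
  let r := Function.surjInv he.1
  have hr (y : Y) : e (r y) = y := Function.surjInv_eq he.1 y
  let d : Y ⟶ Z := ConcreteCategory.ofHom ⟨fun y => a (r y), continuous_of_specializes
    fun y y' h => specializes_map a (hspec _ _ (by rwa [hr, hr]))⟩
  have hed : e ≫ d = a := by
    ext x
    exact ha _ _ (hr _)
  refine ⟨d, ⟨hed, ?_⟩, fun d' hd' => ?_⟩
  · ext y
    exact (hw (r y)).trans (congrArg b (hr y))
  · ext y
    obtain ⟨x, rfl⟩ := he.1 y
    exact ConcreteCategory.congr_hom (hd'.1.trans hed.symm) x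

theorem stableE_respectsIso : (stableE t0Adjunction.{u}).RespectsIso :=
  inferInstanceAs (MorphismProperty.universally _).RespectsIso

theorem coveringM_respectsIso : (coveringM t0Adjunction.{u}).RespectsIso := by
  have hinj {X Y : AlexDisc.{u}} (i : X ⟶ Y) [IsIso i] : Function.Injective i :=
    ((isIso_iff i).1 inferInstance).1.1
  have hins {X Y : AlexDisc.{u}} (i : X ⟶ Y) {x x' : X} (h : Inseparable x x') :
      Inseparable (i x) (i x') :=
    h.map (ConcreteCategory.hom i).continuous
  refine MorphismProperty.RespectsIso.mk _ (fun i f hf => ?_) (fun i f hf => ?_)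
  · rw [coveringM_iff] at hf ⊢
    exact fun a a' h ha => hinj i.hom (hf _ _ h (hins i.hom ha))
  · rw [coveringM_iff] at hf ⊢
    exact fun a a' h ha => hf _ _ (hinj i.hom h) ha

theorem isFactorizationSystem :
    IsFactorizationSystem (stableE t0Adjunction.{u}) (coveringM t0Adjunction.{u}) where
  left_respectsIso := stableE_respectsIso
  right_respectsIso := coveringM_respectsIso
  factorization := exists_factorization
  orthogonal e m a b he hm w := existsUnique_diagonal e m a b
    ((stableE_iff_surjective_isInducing e).1 he) ((coveringM_iff m).1 hm) w

end AlexDisc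

theorem mainTheorem6 :
    IsFactorizationSystem (stableE AlexDisc.t0Adjunction.{u})
      (coveringM AlexDisc.t0Adjunction.{u}) ∧
    ∀ (A B : AlexDisc.{u}) (f : A ⟶ B),
      (coveringM AlexDisc.t0Adjunction.{u} f ↔
        ∀ b : B, T0Space ((f : A → B) ⁻¹' {b})) ∧
      (stableE AlexDisc.t0Adjunction.{u} f ↔
        Function.Surjective (f : A → B) ∧
        IsLeast {t : TopologicalSpace B |
          @AlexandrovDiscrete B t ∧ Continuous[A.str, t] (f : A → B)} B.str ∧
        ∀ b : B, IndiscreteTopology ((f : A → B) ⁻¹' {b})) :=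
  ⟨AlexDisc.isFactorizationSystem, fun _ _ f =>
    ⟨(AlexDisc.coveringM_iff f).trans (AlexDisc.t0Space_fiber_iff f).symm,
      (AlexDisc.stableE_iff_surjective_isInducing f).trans
        (AlexDisc.surjective_isInducing_iff f)⟩⟩
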